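/- Let $H$ be the $36\times 36$ matrix with entries $\pm1$ whose rows, written with $1$ for $+1$ and $0$ for $-1$, are $$\begin{array}{ll} 000010011110110101111100011110111010 & 111100011010100010111101100110101101\\ 100001001101101011111000111101110101 & 111000111101000100011110110101011011\\ 110000100011010111110001111011101011 & 110001111010001001001111011010110111\\ 011000010110101110100011111111010110 & 100011111100010010100111101101101110\\ 001100001101011101000111111110101101 & 000111111000100101110011110011011101\\ 100110000010111011001111110101011011 & 001111110001001010011001111110111010\\ 010011000101110110011111100010110111 & 011111100010010100101100111101110101\\ 001001100011101101111111000101101110 & 111111000100101000110110011011101011\\ 000100110111011010111110001011011101 & 111110001001010001111011001111010110\\ 110110101111101100101011101000111000 & 110111010111000111001010010111101100\\ 101101011011110110010111011001110000 & 101110101110001111010100100011110110\\ 011010111001111011101110110011100000 & 011101011100011111101001000001111011\\ 110101110100111101011101101111000000 & 111010110000111111010010001100111101\\ 101011101110011110111011010110000001 & 110101101001111110100100010110011110\\ 010111011011001111110110101100000011 & 101011011011111100001000101011001111\\ 101110110101100111101101011000000111 & 010110111111111000010001010101100111\\ 011101101110110011011010111000001110 & 101101110111110001100010100110110011\\ 111011010111011001110101110000011100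 & 011011101111100011000101001111011001 \end{array}$$ (rows $1$ to $18$ in the left column, rows $19$ to $36$ in the right column). Definitions. A regular Hadamard matrix of order $s$ is an $s\times s$ matrix $K$ with entries $\pm1$, $KK^T=sI$ and constant row sum. An orthogonal array of size $s^2\times N$ on $s$ symbols is an $s^2\times N$ array such that in any two distinct columns every ordered pair of symbols occurs in exactly one row. For a finite field $F$, let $A_F$ be the orthogonal array with rows $(x,y)\in F^2$ and columns $t\in F\cup\{\infty\}$ whose entry is $tx+y$ for $t\in F$ and $x$ for $t=\infty$; a MacNeish array for $s=q_1q_2$, with $q_1,q_2$ prime powers, is the direct product of $N$ chosen columns of $A_{\mathbb F_{q_1}}$ and $N$ chosen columns of $A_{\mathbb F_{q_2}}$ (rows and symbols are pairs), up to the naming of rows and symbols. A symmetric $(v,k,\lambda)$-design consists of $v$ points and $v$ distinct blocks (sets of points) such that every block has $k$ points, every point is in $k$ blocks, any two distinct points are in exactly $\lambda$ common blocks and any two distinct blocks meet in exactly $\lambda$ points. An $LSSD(v,k,\lambda;w)$, $w\ge2$, is a graph $\Gamma$ whose vertex set is partitioned into $w$ fibres $X_1,\dots,X_w$ of size $v$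 such that (i) no edge has both ends in one fibre; (ii) for $i\ne j$ the graph between $X_i$ and $X_j$ is the incidence graph of a symmetric $(v,k,\lambda)$-design; (iii) there are constants $\mu,\nu$ such that, for distinct $h,i,j$ and $a\in X_i$, $b\in X_j$, the number of common neighbours of $a$ and $b$ in $X_h$ is $\mu$ if $a\sim b$ and $\nu$ if $a\not\sim b$. It is optimistic if $(2k-v)(\mu-\nu)>0$. Given an orthogonal array $O$ of size $s^2\times N$ and a Hadamard matrix $K$ of order $s$, for a column $i$ of $O$, a symbol $j$ and $1\le l\le s$ let $M^{i,j,l}\in\{0,\pm1\}^{s^2}$ be the vector that vanishes outside the $s$ rows of $O$ with the symbol $j$ in column $i$ and has the entry $K_{k,l}$ in the $k$-th of these rows, counted from the top. Let $\Gamma(O,K)$ be the graph with the $Ns^2$ vertices $(i,j,l)$ in which $(i,j,l)\sim(i',j',l')$ if and only if $i\ne i'$ and $\langle M^{i,j,l},M^{i',j',l'}\rangle=1$; its fibres are the $N$ sets of vertices with a fixed $i$. Statement. $H$ is a regular Hadamard matrix, and for every $n\ge1$ there is an $LSSD(v,k,\lambda;w)$ with $v=36^{2n}$ and $w=4^n+1$.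 More precisely, for every $n\ge1$ the Kronecker power $H_n=H^{\otimes n}$ is a regular Hadamard matrix of order $36^n$, and there is a MacNeish array $O_n$ for $36^n=4^n\cdot9^n$ which is an orthogonal array of size $36^{2n}\times(4^n+1)$ on $36^n$ symbols and for which $\Gamma(O_n,H_n)$ is an optimistic $LSSD(v,k,\lambda;w)$ with $$v=36^{2n},\qquad k=\tfrac12\left(36^{2n}+36^n\right),\qquad \lambda=\tfrac14\left(36^{2n}+2\cdot36^n\right),\qquad w=4^n+1 .$$ -/

import Mathlib

/-- The incidence relation `I` (`I p b`: the point `p` lies in the block `b`) is that of a symmetric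
2-design with parameters `(v, k, l)`. Distinct blocks are distinct sets of points. -/
structure IsSymmetricDesign {P B : Type*} [Finite P] [Finite B] (I : P → B → Prop)
    (v k l : ℕ) : Prop where
  card_points : Nat.card P = v
  card_blocks : Nat.card B = v
  blocks_distinct : ∀ b b' : B, (∀ p : P, I p b ↔ I p b') → b = b'
  block_size : ∀ b : B, {p : P | I p b}.ncard = k
  point_degree : ∀ p : P, {b : B | I p b}.ncard = k
  points_joint : ∀ p p' : P, p ≠ p' → {b : B | I p b ∧ I p' b}.ncard = l
  blocks_meet : ∀ b b' : B, b ≠ b' → {p : P | I p b ∧ I p b'}.ncard = l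

/-- For `a`, `b` in distinct fibres, both different from the fibre `h`, the number of common
neighbours of `a` and `b` in the fibre `h` is `μ` if `a ∼ b` and `ν` if not. -/
def HasLinkConstants {V : Type*} {w : ℕ} (Γ : SimpleGraph V) (fib : V → Fin w) (μ ν : ℕ) : Prop :=
  ∀ (h : Fin w) (a b : V), fib a ≠ fib b → h ≠ fib a → h ≠ fib b →
    (Γ.Adj a b → {c : V | fib c = h ∧ Γ.Adj a c ∧ Γ.Adj b c}.ncard = μ) ∧
    (¬ Γ.Adj a b → {c : V | fib c = h ∧ Γ.Adj a c ∧ Γ.Adj b c}.ncard = ν)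

/-- `Γ`, with the fibres `{x | fib x = i}` for `i : Fin w`, is a (homogeneous) linked system of
symmetric designs `LSSD(v, k, l; w)`. -/
structure IsLSSD {V : Type*} [Finite V] {w : ℕ} (Γ : SimpleGraph V) (fib : V → Fin w)
    (v k l : ℕ) : Prop where
  two_le : 2 ≤ w
  no_edge : ∀ x y : V, fib x = fib y → ¬ Γ.Adj x y
  design : ∀ i j : Fin w, i ≠ j →
    IsSymmetricDesign (fun (p : {x : V // fib x = i}) (b : {x : V // fib x = j}) =>
      Γ.Adj p.1 b.1) v k l
  linked : ∃ μ ν : ℕ, HasLinkConstants Γ fib μ ν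

/-- A linked system with block size `k` on fibres of size `v` is optimistic if
`(2k - v)(μ - ν) > 0`. -/
def IsOptimistic {V : Type*} {w : ℕ} (Γ : SimpleGraph V) (fib : V → Fin w) (v k : ℕ) : Prop :=
  ∃ μ ν : ℕ, HasLinkConstants Γ fib μ ν ∧
    0 < (2 * (k : ℤ) - (v : ℤ)) * ((μ : ℤ) - (ν : ℤ))

/-- A real Hadamard matrix of order `s` with constant row sum. -/
structure IsRegularHadamard {s : ℕ} (H : Matrix (Fin s) (Fin s) ℤ) : Prop where
  entries : ∀ i j, H i j = 1 ∨ H i j = -1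
  mul_transpose : H * H.transpose = (s : ℤ) • (1 : Matrix (Fin s) (Fin s) ℤ)
  regular : ∃ c : ℤ, ∀ i, ∑ j, H i j = c

/-- The Kronecker power `H ⊗ ⋯ ⊗ H` (`n` factors); an index of the power is read as the string of
its `n` digits in base `m`. -/
def kroneckerPow {m : ℕ} (H : Matrix (Fin m) (Fin m) ℤ) (n : ℕ) :
    Matrix (Fin (m ^ n)) (Fin (m ^ n)) ℤ :=
  fun x y => ∏ i : Fin n, H (finFunctionFinEquiv.symm x i) (finFunctionFinEquiv.symm y i)

/-- The rows of the sign pattern of `hadamard36`: the decimal digits of each number, padded with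
leading zeros to 36 digits and read from left to right, with `1` for `+` and `0` for `-`. -/
def hadamard36Rows : Fin 36 → ℕ :=
  ![000010011110110101111100011110111010,
    100001001101101011111000111101110101,
    110000100011010111110001111011101011,
    011000010110101110100011111111010110,
    001100001101011101000111111110101101,
    100110000010111011001111110101011011,
    010011000101110110011111100010110111,
    001001100011101101111111000101101110,
    000100110111011010111110001011011101,
    110110101111101100101011101000111000,
    101101011011110110010111011001110000,
    011010111001111011101110110011100000,
    110101110100111101011101101111000000,
    101011101110011110111011010110000001,
    010111011011001111110110101100000011,
    101110110101100111101101011000000111,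
    011101101110110011011010111000001110,
    111011010111011001110101110000011100,
    111100011010100010111101100110101101,
    111000111101000100011110110101011011,
    110001111010001001001111011010110111,
    100011111100010010100111101101101110,
    000111111000100101110011110011011101,
    001111110001001010011001111110111010,
    011111100010010100101100111101110101,
    111111000100101000110110011011101011,
    111110001001010001111011001111010110,
    110111010111000111001010010111101100,
    101110101110001111010100100011110110,
    011101011100011111101001000001111011,
    111010110000111111010010001100111101,
    110101101001111110100100010110011110,
    101011011011111100001000101011001111,
    010110111111111000010001010101100111,
    101101110111110001100010100110110011,
    011011101111100011000101001111011001]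

/-- The explicit regular Hadamard matrix of order 36. -/
def hadamard36 : Matrix (Fin 36) (Fin 36) ℤ :=
  fun i j => if hadamard36Rows i / 10 ^ (35 - (j : ℕ)) % 10 = 1 then 1 else -1

/-- An orthogonal array of size `s² × N` on `s` symbols: in any two columns each ordered pair of
symbols occurs in exactly one row. -/
def IsOrthogonalArray {m N s : ℕ} (O : Fin m → Fin N → Fin s) : Prop :=
  m = s ^ 2 ∧ ∀ c c' : Fin N, c ≠ c' → ∀ a b : Fin s, ∃! r : Fin m, O r c = a ∧ O r c' = b

/-- The array with `|F|²` rows `(x, y)` and `|F| + 1` columns over a field `F`: the column `t ∈ F`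
has the entries `t x + y`, and the column at infinity has the entries `x`. -/
def fieldArray {F : Type} [Field F] (r : F × F) : Option F → F
  | none => r.1
  | some t => t * r.1 + r.2

/-- An array obtained by the MacNeish construction for `s = q₁ q₂`: up to the naming of rows and
symbols it is the direct product of arrays over two finite fields, of orders `q₁` and `q₂`, each
restricted to `N` of its columns. -/
def IsMacNeishArray {m N s : ℕ} (q₁ q₂ : ℕ) (O : Fin m → Fin N → Fin s) : Prop :=
  ∃ (F₁ F₂ : Type) (_ : Field F₁) (_ : Field F₂) (ρ : Fin m ≃ (F₁ × F₁) × (F₂ × F₂))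
    (σ : Fin s ≃ F₁ × F₂) (κ₁ : Fin N ↪ Option F₁) (κ₂ : Fin N ↪ Option F₂),
    Nat.card F₁ = q₁ ∧ Nat.card F₂ = q₂ ∧
    ∀ r c, σ (O r c) = (fieldArray (ρ r).1 (κ₁ c), fieldArray (ρ r).2 (κ₂ c))

/-- The vector attached to the column `i` of an array `O`, a symbol `j` and a column `l` of `H`:
it is supported on the rows of `O` that have the symbol `j` in column `i`, and its entry in the
`k`-th of these rows, counted from the top, is `H k l`. -/
def arrayVector {m N s : ℕ} (O : Fin m → Fin N → Fin s) (H : Matrix (Fin s) (Fin s) ℤ)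
    (x : Fin N × Fin s × Fin s) (r : Fin m) : ℤ :=
  if O r x.1 = x.2.1 then
    if hk : (Finset.univ.filter fun r' : Fin m => r' < r ∧ O r' x.1 = x.2.1).card < s then
      H ⟨(Finset.univ.filter fun r' : Fin m => r' < r ∧ O r' x.1 = x.2.1).card, hk⟩ x.2.2
    else 0
  else 0

/-- The graph of an orthogonal array `O` and a Hadamard matrix `H`: the vertices are the vectors
of the bases attached to the columns of `O`, the bases are the fibres, and vectors in different
bases are adjacent if their inner product (which is `1` or `-1`) is `1`. -/
def arrayGraph {m N s : ℕ} (O : Fin m → Fin N → Fin s) (H : Matrix (Fin s) (Fin s) ℤ) :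
    SimpleGraph (Fin N × Fin s × Fin s) where
  Adj x y := x.1 ≠ y.1 ∧ ∑ r, arrayVector O H x r * arrayVector O H y r = 1
  symm := ⟨fun x y h => ⟨h.1.symm, by simpa only [mul_comm] using h.2⟩⟩
  loopless := ⟨fun x h => h.1 rfl⟩

/-! Write s = 36 ^ n. Each column of the array gives an orthogonal basis of ℝ^(s²) of vectors of
squared norm s, and supports from different columns share one row, so such inner products are ±1: up
to scaling, the bases are mutually unbiased. For vectors x, y and a basis B, Parseval gives ∑
⟨x,b⟩⟨y,b⟩ = s⟨x,y⟩ (`sum_arrayInner_mul`). Regularity gives ∑ ⟨x,b⟩ = s (`sum_arrayInner`): both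
the sum of B at each row and the coordinate sum of x equal c, with c² = s. Hence, for x, y outside
the fibre of B, the number of common neighbours in it is (s² + 2s + s⟨x,y⟩)/4
(`four_mul_ncard_common`). The values s, 0, 1, -1 of ⟨x,y⟩ yield k, λ, μ, ν. -/

/-! ### The matrix of order 36 -/

theorem hadamard36_entries (i j : Fin 36) : hadamard36 i j = 1 ∨ hadamard36 i j = -1 := by
  unfold hadamard36
  split_ifs <;> simp

theorem hadamard36_sum_mul_of_lt : ∀ i j : Fin 36, i < j →
    ∑ k, hadamard36 i k * hadamard36 j k = 0 := by
  decide +kernel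

theorem hadamard36_sum_row : ∀ i : Fin 36, ∑ j, hadamard36 i j = 6 := by
  decide +kernel

theorem isRegularHadamard_hadamard36 : IsRegularHadamard hadamard36 where
  entries := hadamard36_entries
  mul_transpose := by
    ext i j
    rw [Matrix.mul_apply, Matrix.smul_apply, Matrix.one_apply]
    simp only [Matrix.transpose_apply]
    rcases lt_trichotomy i j with h | rfl | h
    · simp [hadamard36_sum_mul_of_lt i j h, h.ne]
    · have h1 : ∀ k, hadamard36 i k * hadamard36 i k = 1 := fun k => by
        rcases hadamard36_entries i k with h | h <;> simp [h]
      simp [h1]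
    · simp only [mul_comm (hadamard36 i _)]
      simp [hadamard36_sum_mul_of_lt j i h, h.ne']
  regular := ⟨6, hadamard36_sum_row⟩

/-! ### Kronecker powers and sums in regular Hadamard matrices -/

theorem prod_eq_one_or_neg_one {ι : Type*} (S : Finset ι) (f : ι → ℤ)
    (hf : ∀ i, f i = 1 ∨ f i = -1) : ∏ i ∈ S, f i = 1 ∨ ∏ i ∈ S, f i = -1 := by
  induction S using Finset.cons_induction with
  | empty => simp
  | cons a S ha ih =>
    rw [Finset.prod_cons]
    rcases hf a with h | h <;> rcases ih with h' | h' <;> simp [h, h']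

theorem sum_prod_digits {m : ℕ} (n : ℕ) (f : Fin n → Fin m → ℤ) :
    ∑ z : Fin (m ^ n), ∏ i, f i (finFunctionFinEquiv.symm z i) = ∏ i, ∑ a, f i a := by
  rw [Finset.prod_univ_sum, Fintype.piFinset_univ]
  exact Equiv.sum_comp finFunctionFinEquiv.symm fun z : Fin n → Fin m => ∏ i, f i (z i)

theorem IsRegularHadamard.sum_mul {s : ℕ} {K : Matrix (Fin s) (Fin s) ℤ}
    (hK : IsRegularHadamard K) (i j : Fin s) :
    ∑ k, K i k * K j k = if i = j then (s : ℤ) else 0 := by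
  have := congrFun (congrFun hK.mul_transpose i) j
  simpa [Matrix.mul_apply, Matrix.one_apply] using this

theorem IsRegularHadamard.kroneckerPow {m : ℕ} {H : Matrix (Fin m) (Fin m) ℤ}
    (hH : IsRegularHadamard H) (n : ℕ) : IsRegularHadamard (kroneckerPow H n) where
  entries x y := prod_eq_one_or_neg_one _ _ fun _ => hH.entries _ _
  mul_transpose := by
    ext x y
    simp only [Matrix.mul_apply, Matrix.transpose_apply, _root_.kroneckerPow,
      ← Finset.prod_mul_distrib]
    rw [sum_prod_digits n fun i a => H (finFunctionFinEquiv.symm x i) a *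
      H (finFunctionFinEquiv.symm y i) a]
    simp only [hH.sum_mul]
    by_cases hxy : x = y
    · simp [hxy]
    · obtain ⟨i, hi⟩ : ∃ i, finFunctionFinEquiv.symm x i ≠ finFunctionFinEquiv.symm y i := by
        by_contra! h
        exact hxy (finFunctionFinEquiv.symm.injective (funext h))
      rw [Finset.prod_eq_zero (Finset.mem_univ i) (if_neg hi)]
      simp [hxy]
  regular := by
    obtain ⟨c, hc⟩ := hH.regular
    refine ⟨c ^ n, fun x => ?_⟩
    simp only [_root_.kroneckerPow]
    rw [sum_prod_digits n fun i a => H (finFunctionFinEquiv.symm x i) a]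
    simp [hc]

/-- Over ℚ, s⁻¹Kᵀ is a right inverse of the square matrix K, hence also a left inverse. -/
theorem IsRegularHadamard.sum_mul_col {s : ℕ} {K : Matrix (Fin s) (Fin s) ℤ}
    (hK : IsRegularHadamard K) (i j : Fin s) :
    ∑ k, K k i * K k j = if i = j then (s : ℤ) else 0 := by
  have hs : (s : ℚ) ≠ 0 := by exact_mod_cast (Fin.pos i).ne'
  let A : Matrix (Fin s) (Fin s) ℚ := K.map Int.cast
  have h1 : A * ((s : ℚ)⁻¹ • A.transpose) = 1 := by
    ext i j
    have h := congrArg (Int.cast : ℤ → ℚ) (hK.sum_mul i j)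
    push_cast at h
    rw [Matrix.mul_smul, Matrix.smul_apply, Matrix.mul_apply, Matrix.one_apply]
    simp only [A, Matrix.transpose_apply, Matrix.map_apply, smul_eq_mul, h]
    split_ifs <;> simp [hs]
  have h1' : ((s : ℚ)⁻¹ • A.transpose) * A = 1 := mul_eq_one_comm.mp h1
  have h2 := congrFun (congrFun h1' i) j
  rw [Matrix.smul_mul, Matrix.smul_apply, Matrix.mul_apply, Matrix.one_apply, smul_eq_mul,
    inv_mul_eq_iff_eq_mul₀ hs] at h2
  simp only [A, Matrix.transpose_apply, Matrix.map_apply] at h2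
  have h3 : ((∑ k, K k i * K k j : ℤ) : ℚ) = ((if i = j then (s : ℤ) else 0 : ℤ) : ℚ) := by
    push_cast
    rw [h2]
    split_ifs <;> simp
  exact_mod_cast h3

/-- The row sums and the column sums of a regular Hadamard matrix agree, and their square is the
order. -/
theorem IsRegularHadamard.exists_sum {s : ℕ} {K : Matrix (Fin s) (Fin s) ℤ}
    (hK : IsRegularHadamard K) (hs : 0 < s) :
    ∃ c : ℤ, c * c = s ∧ (∀ i, ∑ j, K i j = c) ∧ ∀ j, ∑ i, K i j = c := by
  obtain ⟨c, hc⟩ := hK.regular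
  -- Entry l of KᵀK𝟙, evaluated once through K𝟙 = c𝟙 and once through KᵀK = sI.
  have hcol : ∀ l, c * ∑ k, K k l = s := fun l => by
    calc c * ∑ k, K k l = ∑ k, K k l * ∑ j, K k j := by
          rw [Finset.mul_sum]
          exact Finset.sum_congr rfl fun k _ => by rw [hc, mul_comm]
      _ = ∑ j, ∑ k, K k l * K k j := by
          simp only [Finset.mul_sum]
          exact Finset.sum_comm
      _ = s := by simp [hK.sum_mul_col]
  have hs' : (s : ℤ) ≠ 0 := by positivity
  -- Summing over all columns counts the total of the entries, which is sc by rows.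
  have hcc : c * c = s := by
    have h1 : ∑ l, c * ∑ k, K k l = (s : ℤ) * s := by simp [hcol]
    rw [← Finset.mul_sum, Finset.sum_comm] at h1
    simp only [hc, Finset.sum_const, Finset.card_univ, Fintype.card_fin, nsmul_eq_mul] at h1
    exact mul_left_cancel₀ hs' (by linarith)
  have hc0 : c ≠ 0 := by
    rintro rfl
    exact hs' (by simpa using hcc.symm)
  exact ⟨c, hcc, hc, fun l => mul_left_cancel₀ hc0 ((hcol l).trans hcc.symm)⟩

/-! ### Orthogonal arrays from finite fields -/

/-- The orthogonal array of lines of the affine plane over a field. -/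
theorem existsUnique_fieldArray {F : Type} [Field F] {t t' : Option F} (h : t ≠ t') (a b : F) :
    ∃! r : F × F, fieldArray r t = a ∧ fieldArray r t' = b := by
  rcases t with _ | t <;> rcases t' with _ | t'
  · exact absurd rfl h
  · refine ⟨(a, b - t' * a), by simp [fieldArray], ?_⟩
    rintro ⟨x, y⟩ ⟨h1, h2⟩
    simp only [fieldArray] at h1 h2
    subst h1
    simp [← h2]
  · refine ⟨(b, a - t * b), by simp [fieldArray], ?_⟩
    rintro ⟨x, y⟩ ⟨h1, h2⟩
    simp only [fieldArray] at h1 h2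
    subst h2
    simp [← h1]
  · have ht : t - t' ≠ 0 := sub_ne_zero.mpr fun h' => h (by rw [h'])
    refine ⟨((a - b) / (t - t'), a - t * ((a - b) / (t - t'))), ⟨?_, ?_⟩, ?_⟩
    · simp [fieldArray]
    · simp only [fieldArray]
      field_simp
      ring
    · rintro ⟨x, y⟩ ⟨h1, h2⟩
      simp only [fieldArray] at h1 h2
      have hx : x = (a - b) / (t - t') := by
        rw [eq_div_iff ht, ← h1, ← h2]
        ring
      rw [← hx, ← h1]
      simp

/-- The two field components of a row are determined independently of each other. -/
theorem IsMacNeishArray.isOrthogonalArray {m N s q₁ q₂ : ℕ} {O : Fin m → Fin N → Fin s}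
    (hO : IsMacNeishArray q₁ q₂ O) (hm : m = s ^ 2) : IsOrthogonalArray O := by
  obtain ⟨F₁, F₂, _, _, ρ, σ, κ₁, κ₂, -, -, h⟩ := hO
  refine ⟨hm, fun c c' hc a b => ?_⟩
  obtain ⟨r₁, h₁, u₁⟩ := existsUnique_fieldArray (κ₁.injective.ne hc) (σ a).1 (σ b).1
  obtain ⟨r₂, h₂, u₂⟩ := existsUnique_fieldArray (κ₂.injective.ne hc) (σ a).2 (σ b).2
  refine ⟨ρ.symm (r₁, r₂), ⟨σ.injective ?_, σ.injective ?_⟩, ?_⟩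
  · rw [h, Equiv.apply_symm_apply, h₁.1, h₂.1]
  · rw [h, Equiv.apply_symm_apply, h₁.2, h₂.2]
  · rintro r ⟨rfl, rfl⟩
    rw [Equiv.eq_symm_apply]
    exact Prod.ext (u₁ _ ⟨by rw [h], by rw [h]⟩) (u₂ _ ⟨by rw [h], by rw [h]⟩)

theorem exists_isMacNeishArray {p₁ p₂ e₁ e₂ N : ℕ} [Fact p₁.Prime] [Fact p₂.Prime]
    (he₁ : e₁ ≠ 0) (he₂ : e₂ ≠ 0) (hN₁ : N ≤ p₁ ^ e₁ + 1) (hN₂ : N ≤ p₂ ^ e₂ + 1) {m s : ℕ}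
    (hs : s = p₁ ^ e₁ * p₂ ^ e₂) (hm : m = s ^ 2) :
    ∃ O : Fin m → Fin N → Fin s, IsMacNeishArray (p₁ ^ e₁) (p₂ ^ e₂) O := by
  let F₁ := GaloisField p₁ e₁
  let F₂ := GaloisField p₂ e₂
  have c₁ : Nat.card F₁ = p₁ ^ e₁ := GaloisField.card p₁ e₁ he₁
  have c₂ : Nat.card F₂ = p₂ ^ e₂ := GaloisField.card p₂ e₂ he₂
  let _ : Fintype F₁ := Fintype.ofFinite F₁
  let _ : Fintype F₂ := Fintype.ofFinite F₂
  have d₁ : Fintype.card F₁ = p₁ ^ e₁ := by rw [← Nat.card_eq_fintype_card, c₁]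
  have d₂ : Fintype.card F₂ = p₂ ^ e₂ := by rw [← Nat.card_eq_fintype_card, c₂]
  obtain ⟨σ⟩ : Nonempty (Fin s ≃ F₁ × F₂) := Fintype.card_eq.mp (by simp [d₁, d₂, hs])
  obtain ⟨ρ⟩ : Nonempty (Fin m ≃ (F₁ × F₁) × (F₂ × F₂)) :=
    Fintype.card_eq.mp (by
      simp only [Fintype.card_fin, Fintype.card_prod, d₁, d₂, hm, hs]
      ring)
  obtain ⟨κ₁⟩ : Nonempty (Fin N ↪ Option F₁) :=
    Function.Embedding.nonempty_of_card_le (by simpa [d₁] using hN₁)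
  obtain ⟨κ₂⟩ : Nonempty (Fin N ↪ Option F₂) :=
    Function.Embedding.nonempty_of_card_le (by simpa [d₂] using hN₂)
  exact ⟨fun r c => σ.symm (fieldArray (ρ r).1 (κ₁ c), fieldArray (ρ r).2 (κ₂ c)),
    F₁, F₂, inferInstance, inferInstance, ρ, σ, κ₁, κ₂, c₁, c₂, fun r c => by simp⟩

/-! ### The vectors of an array and their inner products -/

/-- Column `i` of an orthogonal array cuts the rows into `s` classes of `s` rows; a row is
determined by its class and its position in the class. -/
theorem exists_rowEquiv {m N s : ℕ} {O : Fin m → Fin N → Fin s} (hO : IsOrthogonalArray O)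
    (hN : 2 ≤ N) (i : Fin N) :
    ∃ φ : Fin m ≃ Fin s × Fin s, (∀ r, (φ r).1 = O r i) ∧
      ∀ (H : Matrix (Fin s) (Fin s) ℤ) (j l : Fin s) (r : Fin m),
        arrayVector O H (i, j, l) r = if (φ r).1 = j then H (φ r).2 l else 0 := by
  obtain ⟨hm, hO⟩ := hO
  obtain ⟨i', hi'⟩ : ∃ i' : Fin N, i ≠ i' := by
    have : Nontrivial (Fin N) := Fin.nontrivial_iff_two_le.mpr hN
    obtain ⟨i', h⟩ := exists_ne i
    exact ⟨i', h.symm⟩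
  let before (j : Fin s) (r : Fin m) : Finset (Fin m) :=
    Finset.univ.filter fun r' => r' < r ∧ O r' i = j
  -- Rows of one class carry distinct symbols in a second column; this is where N ≥ 2 enters.
  have hclass (j : Fin s) : (Finset.univ.filter fun r => O r i = j).card ≤ s := by
    have : Set.InjOn (fun r => O r i') (Finset.univ.filter fun r => O r i = j : Finset (Fin m)) := by
      intro r hr r' hr' h
      simp only [Finset.coe_filter, Finset.mem_univ, true_and, Set.mem_ofPred_eq] at hr hr'
      exact (hO i i' hi' j (O r i')).unique ⟨hr, rfl⟩ ⟨hr', h.symm⟩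
    simpa using Finset.card_le_card_of_injOn (t := Finset.univ) _ (fun _ _ => by simp) this
  -- So the default value 0 for positions beyond s in `arrayVector` is never reached.
  have hlt (r : Fin m) : (before (O r i) r).card < s := by
    refine lt_of_lt_of_le (Finset.card_lt_card ?_) (hclass (O r i))
    refine Finset.ssubset_iff_of_subset (fun x hx => ?_) |>.mpr ⟨r, by simp, by simp [before]⟩
    simp only [before, Finset.mem_filter, Finset.mem_univ, true_and] at hx ⊢
    exact hx.2
  have hmono {r r' : Fin m} (h : r < r') (h' : O r i = O r' i) :
      (before (O r i) r).card < (before (O r' i) r').card := by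
    refine Finset.card_lt_card ?_
    refine Finset.ssubset_iff_of_subset (fun x hx => ?_) |>.mpr
      ⟨r, by simp [before, h, h'], by simp [before]⟩
    simp only [before, Finset.mem_filter, Finset.mem_univ, true_and] at hx ⊢
    exact ⟨hx.1.trans h, hx.2.trans h'⟩
  let f (r : Fin m) : Fin s × Fin s := (O r i, ⟨(before (O r i) r).card, hlt r⟩)
  have hf : Function.Injective f := by
    intro r r' h
    simp only [f, Prod.mk.injEq, Fin.mk.injEq] at h
    rcases lt_trichotomy r r' with h1 | h1 | h1
    · exact absurd h.2 (hmono h1 h.1).ne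
    · exact h1
    · exact absurd h.2 (hmono h1 h.1.symm).ne'
  have hb : Function.Bijective f :=
    (Fintype.bijective_iff_injective_and_card f).mpr ⟨hf, by simp [hm, sq]⟩
  refine ⟨Equiv.ofBijective f hb, fun r => rfl, fun H j l r => ?_⟩
  simp only [Equiv.ofBijective_apply, f, arrayVector]
  split_ifs with h1 h2
  · subst h1; rfl
  · subst h1; exact absurd (hlt r) h2
  · rfl

/-- For signs, (1 + f)(1 + g) is 4 where both are 1 and 0 elsewhere. -/
theorem four_mul_card_filter {C : Type*} [Fintype C] {f g : C → ℤ}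
    (hf : ∀ c, f c = 1 ∨ f c = -1) (hg : ∀ c, g c = 1 ∨ g c = -1) :
    4 * ((Finset.univ.filter fun c => f c = 1 ∧ g c = 1).card : ℤ) =
      Fintype.card C + ∑ c, f c + ∑ c, g c + ∑ c, f c * g c := by
  rw [Finset.card_filter, Nat.cast_sum, Finset.mul_sum, ← Finset.card_univ,
    Finset.cast_card, ← Finset.sum_add_distrib, ← Finset.sum_add_distrib,
    ← Finset.sum_add_distrib]
  refine Finset.sum_congr rfl fun c _ => ?_
  rcases hf c with h | h <;> rcases hg c with h' | h' <;> simp [h, h']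

/-- The inner product of the vectors attached to two vertices. -/
def arrayInner {m N s : ℕ} (O : Fin m → Fin N → Fin s) (H : Matrix (Fin s) (Fin s) ℤ)
    (x y : Fin N × Fin s × Fin s) : ℤ :=
  ∑ r, arrayVector O H x r * arrayVector O H y r

theorem arrayInner_comm {m N s : ℕ} (O : Fin m → Fin N → Fin s) (H : Matrix (Fin s) (Fin s) ℤ)
    (x y : Fin N × Fin s × Fin s) : arrayInner O H x y = arrayInner O H y x :=
  Finset.sum_congr rfl fun _ _ => mul_comm _ _

section

variable {m N s : ℕ} {O : Fin m → Fin N → Fin s} {H : Matrix (Fin s) (Fin s) ℤ}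

/-- The supports meet in a single row, so the inner product is one product of two signs. -/
theorem arrayInner_eq_one_or_neg_one (hO : IsOrthogonalArray O) (hN : 2 ≤ N)
    (hH : IsRegularHadamard H) {x y : Fin N × Fin s × Fin s} (hxy : x.1 ≠ y.1) :
    arrayInner O H x y = 1 ∨ arrayInner O H x y = -1 := by
  obtain ⟨i, j, l⟩ := x
  obtain ⟨i', j', l'⟩ := y
  obtain ⟨φ, h1, hφ⟩ := exists_rowEquiv hO hN i
  obtain ⟨ψ, h1', hψ⟩ := exists_rowEquiv hO hN i'
  obtain ⟨r, ⟨hr, hr'⟩, hu⟩ := hO.2 i i' hxy j j'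
  have : arrayInner O H (i, j, l) (i', j', l') = H (φ r).2 l * H (ψ r).2 l' := by
    rw [arrayInner, Finset.sum_eq_single r]
    · rw [hφ, hψ, if_pos ((h1 r).trans hr), if_pos ((h1' r).trans hr')]
    · intro q _ hq
      rw [hφ, hψ, h1, h1']
      split_ifs with h2 h3
      · exact absurd (hu q ⟨h2, h3⟩) hq
      all_goals simp
    · simp
  rw [this]
  rcases hH.entries (φ r).2 l with h | h <;> rcases hH.entries (ψ r).2 l' with h' | h' <;>
    simp [h, h']

theorem arrayInner_fibre (hO : IsOrthogonalArray O) (hN : 2 ≤ N)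
    (hH : IsRegularHadamard H) (i : Fin N) (d e : Fin s × Fin s) :
    arrayInner O H (i, d) (i, e) = if d = e then (s : ℤ) else 0 := by
  obtain ⟨j, l⟩ := d
  obtain ⟨j', l'⟩ := e
  obtain ⟨φ, -, hφ⟩ := exists_rowEquiv hO hN i
  simp only [arrayInner, hφ]
  rw [φ.sum_comp fun p => (if p.1 = j then H p.2 l else 0) * if p.1 = j' then H p.2 l' else 0,
    Fintype.sum_prod_type, Finset.sum_eq_single j]
  · by_cases h : j = j' <;> simp [h, hH.sum_mul_col]
  · intro q _ hq
    simp [hq]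
  · simp

/-- Completeness of the basis of column `i`: rows in different classes lie in no common support, and
within a class the rows of `H` are orthogonal. -/
theorem sum_arrayVector_mul (hO : IsOrthogonalArray O) (hN : 2 ≤ N)
    (hH : IsRegularHadamard H) (i : Fin N) (r r' : Fin m) :
    ∑ d, arrayVector O H (i, d) r * arrayVector O H (i, d) r' =
      if r = r' then (s : ℤ) else 0 := by
  obtain ⟨φ, -, hφ⟩ := exists_rowEquiv hO hN i
  simp only [Fintype.sum_prod_type, hφ]
  rw [Finset.sum_eq_single (φ r).1]
  · have h : r = r' ↔ (φ r').1 = (φ r).1 ∧ (φ r).2 = (φ r').2 := by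
      rw [← φ.apply_eq_iff_eq, Prod.ext_iff, eq_comm (a := (φ r).1)]
    by_cases h1 : (φ r').1 = (φ r).1 <;> simp [h, h1, hH.sum_mul]
  · intro q _ hq
    simp [hq.symm]
  · simp

theorem sum_arrayInner_mul (hO : IsOrthogonalArray O) (hN : 2 ≤ N)
    (hH : IsRegularHadamard H) (h : Fin N) (x y : Fin N × Fin s × Fin s) :
    ∑ d, arrayInner O H x (h, d) * arrayInner O H y (h, d) = s * arrayInner O H x y := by
  calc ∑ d, arrayInner O H x (h, d) * arrayInner O H y (h, d)
      = ∑ r, ∑ r', arrayVector O H x r * arrayVector O H y r' *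
          ∑ d, arrayVector O H (h, d) r * arrayVector O H (h, d) r' := by
        simp_rw [arrayInner, Finset.sum_mul_sum, Finset.mul_sum]
        rw [Finset.sum_comm]
        refine Finset.sum_congr rfl fun r _ => ?_
        rw [Finset.sum_comm]
        exact Finset.sum_congr rfl fun r' _ => Finset.sum_congr rfl fun d _ => by ring
    _ = s * arrayInner O H x y := by
        simp only [sum_arrayVector_mul hO hN hH, arrayInner, Finset.mul_sum]
        exact Finset.sum_congr rfl fun r _ => by simp [mul_comm]

theorem sum_arrayInner (hO : IsOrthogonalArray O) (hN : 2 ≤ N) (hs : 0 < s)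
    (hH : IsRegularHadamard H) (h : Fin N) (x : Fin N × Fin s × Fin s) :
    ∑ d, arrayInner O H x (h, d) = s := by
  obtain ⟨c, hc, hrow, hcol⟩ := hH.exists_sum hs
  have h1 : ∀ r, ∑ d, arrayVector O H (h, d) r = c := fun r => by
    obtain ⟨φ, -, hφ⟩ := exists_rowEquiv hO hN h
    simp only [Fintype.sum_prod_type, hφ]
    rw [Finset.sum_eq_single (φ r).1]
    · simp [hrow]
    · intro q _ hq
      simp [hq.symm]
    · simp
  have h2 : ∑ r, arrayVector O H x r = c := by
    obtain ⟨i, j, l⟩ := x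
    obtain ⟨φ, -, hφ⟩ := exists_rowEquiv hO hN i
    simp only [hφ]
    rw [φ.sum_comp fun p => if p.1 = j then H p.2 l else 0, Fintype.sum_prod_type,
      Finset.sum_eq_single j]
    · simp [hcol]
    · intro q _ hq
      simp [hq]
    · simp
  simp only [arrayInner]
  rw [Finset.sum_comm]
  simp only [← Finset.mul_sum, h1]
  rw [← Finset.sum_mul, h2, hc]

/-! ### Counting neighbours; designs and links -/

theorem arrayGraph_adj {x y : Fin N × Fin s × Fin s} :
    (arrayGraph O H).Adj x y ↔ x.1 ≠ y.1 ∧ arrayInner O H x y = 1 := Iff.rfl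

theorem ncard_fibre {A B : Type*} [Finite B] (i : A) (P : A × B → Prop) :
    {x : A × B | x.1 = i ∧ P x}.ncard = {d : B | P (i, d)}.ncard := by
  have : {x : A × B | x.1 = i ∧ P x} = Prod.mk i '' {d : B | P (i, d)} := by
    ext ⟨a, b⟩
    simp only [Set.mem_ofPred_eq, Set.mem_image, Prod.mk.injEq]
    constructor
    · rintro ⟨rfl, h⟩
      exact ⟨b, h, rfl, rfl⟩
    · rintro ⟨d, h, rfl, rfl⟩
      exact ⟨rfl, h⟩
  rw [this, Set.ncard_image_of_injective _ (Prod.mk_right_injective i)]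

theorem ncard_subtype_fibre {A B : Type*} [Finite B] (i : A) (P : A × B → Prop) :
    {x : {x : A × B // x.1 = i} | P x.1}.ncard = {d : B | P (i, d)}.ncard := by
  rw [← ncard_fibre, ← Set.ncard_image_of_injective _ Subtype.val_injective]
  congr 1
  ext x
  simp [and_comm]

theorem four_mul_ncard_common (hO : IsOrthogonalArray O) (hN : 2 ≤ N) (hs : 0 < s)
    (hH : IsRegularHadamard H) {h : Fin N} {x y : Fin N × Fin s × Fin s} (hx : x.1 ≠ h)
    (hy : y.1 ≠ h) :
    4 * ({d : Fin s × Fin s | (arrayGraph O H).Adj x (h, d) ∧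
      (arrayGraph O H).Adj y (h, d)}.ncard : ℤ) = s ^ 2 + 2 * s + s * arrayInner O H x y := by
  have h1 : {d : Fin s × Fin s | (arrayGraph O H).Adj x (h, d) ∧ (arrayGraph O H).Adj y (h, d)} =
      (Finset.univ.filter fun d => arrayInner O H x (h, d) = 1 ∧ arrayInner O H y (h, d) = 1 :
        Finset (Fin s × Fin s)) := by
    ext d
    simp [arrayGraph_adj, hx, hy]
  rw [h1, Set.ncard_coe_finset, four_mul_card_filter
    (fun d => arrayInner_eq_one_or_neg_one hO hN hH hx)
    (fun d => arrayInner_eq_one_or_neg_one hO hN hH hy), sum_arrayInner hO hN hs hH,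
    sum_arrayInner hO hN hs hH, sum_arrayInner_mul hO hN hH]
  simp only [Fintype.card_prod, Fintype.card_fin, Nat.cast_mul]
  ring

theorem four_mul_ncard_common_fibre (hO : IsOrthogonalArray O) (hN : 2 ≤ N) (hs : 0 < s)
    (hH : IsRegularHadamard H) {h : Fin N} {x y : Fin N × Fin s × Fin s} (hx : x.1 ≠ h)
    (hxy : x.1 = y.1) (hne : x ≠ y) :
    4 * {d : Fin s × Fin s | (arrayGraph O H).Adj x (h, d) ∧
      (arrayGraph O H).Adj y (h, d)}.ncard = s ^ 2 + 2 * s := by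
  have h1 := four_mul_ncard_common hO hN hs hH hx (hxy ▸ hx : y.1 ≠ h)
  obtain ⟨i, d⟩ := x
  obtain ⟨i', e⟩ := y
  obtain rfl : i = i' := hxy
  rw [arrayInner_fibre hO hN hH, if_neg (fun h => hne (by rw [h]))] at h1
  zify
  linarith

/-- The count of common neighbours with y = x, where the inner product is s. -/
theorem two_mul_ncard_neighbors (hO : IsOrthogonalArray O) (hN : 2 ≤ N) (hs : 0 < s)
    (hH : IsRegularHadamard H) {h : Fin N} {x : Fin N × Fin s × Fin s} (hx : x.1 ≠ h) :
    2 * {d : Fin s × Fin s | (arrayGraph O H).Adj x (h, d)}.ncard = s ^ 2 + s := by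
  have h1 := four_mul_ncard_common hO hN hs hH hx hx
  simp only [and_self] at h1
  obtain ⟨i, d⟩ := x
  rw [arrayInner_fibre hO hN hH, if_pos rfl] at h1
  zify
  linarith

theorem isSymmetricDesign_arrayGraph (hO : IsOrthogonalArray O) (hN : 2 ≤ N) (hs : 0 < s)
    (hH : IsRegularHadamard H) {k l : ℕ} (hk : 2 * k = s ^ 2 + s) (hl : 4 * l = s ^ 2 + 2 * s)
    {i j : Fin N} (hij : i ≠ j) :
    IsSymmetricDesign (fun (p : {x : Fin N × Fin s × Fin s // x.1 = i})
      (b : {x : Fin N × Fin s × Fin s // x.1 = j}) => (arrayGraph O H).Adj p.1 b.1)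
      (s ^ 2) k l := by
  have hcard (i : Fin N) : Nat.card {x : Fin N × Fin s × Fin s // x.1 = i} = s ^ 2 := by
    have := ncard_subtype_fibre (B := Fin s × Fin s) i fun _ => True
    simpa [Set.ncard_univ, sq] using this
  have hdeg {i j : Fin N} (hij : i ≠ j) (p : {x : Fin N × Fin s × Fin s // x.1 = i}) :
      {b : {x : Fin N × Fin s × Fin s // x.1 = j} | (arrayGraph O H).Adj p.1 b.1}.ncard = k := by
    rw [ncard_subtype_fibre j fun b => (arrayGraph O H).Adj p.1 b]
    have := two_mul_ncard_neighbors hO hN hs hH (h := j) (x := p.1) (by rwa [p.2])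
    omega
  have hjoint {i j : Fin N} (hij : i ≠ j) (p p' : {x : Fin N × Fin s × Fin s // x.1 = i})
      (hp : p ≠ p') : {b : {x : Fin N × Fin s × Fin s // x.1 = j} |
        (arrayGraph O H).Adj p.1 b.1 ∧ (arrayGraph O H).Adj p'.1 b.1}.ncard = l := by
    rw [ncard_subtype_fibre j fun b => (arrayGraph O H).Adj p.1 b ∧ (arrayGraph O H).Adj p'.1 b]
    have := four_mul_ncard_common_fibre hO hN hs hH (h := j) (x := p.1) (y := p'.1)
      (by rwa [p.2]) (by rw [p.2, p'.2]) (fun h => hp (Subtype.ext h))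
    omega
  have hmeet (b b' : {x : Fin N × Fin s × Fin s // x.1 = j}) (hb : b ≠ b') :
      {p : {x : Fin N × Fin s × Fin s // x.1 = i} |
        (arrayGraph O H).Adj p.1 b.1 ∧ (arrayGraph O H).Adj p.1 b'.1}.ncard = l := by
    simp only [(arrayGraph O H).adj_comm _ b.1, (arrayGraph O H).adj_comm _ b'.1]
    exact hjoint hij.symm b b' hb
  have hsize (b : {x : Fin N × Fin s × Fin s // x.1 = j}) :
      {p : {x : Fin N × Fin s × Fin s // x.1 = i} | (arrayGraph O H).Adj p.1 b.1}.ncard = k := by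
    simp only [(arrayGraph O H).adj_comm _ b.1]
    exact hdeg hij.symm b
  refine ⟨hcard i, hcard j, fun b b' hbb => ?_, hsize, hdeg hij, hjoint hij, hmeet⟩
  -- Two distinct blocks with the same points would force k = l, but 4k - 4l = s².
  by_contra hb
  have h1 := hmeet b b' hb
  simp only [← hbb, and_self, hsize] at h1
  have : 0 < s ^ 2 := by positivity
  omega

theorem hasLinkConstants_arrayGraph (hO : IsOrthogonalArray O) (hN : 2 ≤ N) (hs : 0 < s)
    (hH : IsRegularHadamard H) {μ ν : ℕ} (hμ : 4 * μ = s ^ 2 + 3 * s) (hν : 4 * ν = s ^ 2 + s) :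
    HasLinkConstants (arrayGraph O H) Prod.fst μ ν := by
  intro h a b hab ha hb
  rw [ncard_fibre h fun c => (arrayGraph O H).Adj a c ∧ (arrayGraph O H).Adj b c]
  have h1 := four_mul_ncard_common hO hN hs hH ha.symm hb.symm
  rw [arrayGraph_adj]
  zify at hμ hν ⊢
  refine ⟨fun h2 => ?_, fun h2 => ?_⟩
  · rw [h2.2] at h1
    linarith
  · rw [(arrayInner_eq_one_or_neg_one hO hN hH hab).resolve_left fun h3 => h2 ⟨hab, h3⟩] at h1
    linarith

end

/-! ### The main theorem -/

theorem mainTheorem5 (n : ℕ) (hn : 1 ≤ n) :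
    IsRegularHadamard hadamard36 ∧
    IsRegularHadamard (kroneckerPow hadamard36 n) ∧
    ∃ O : Fin (36 ^ (2 * n)) → Fin (4 ^ n + 1) → Fin (36 ^ n),
      IsOrthogonalArray O ∧ IsMacNeishArray (4 ^ n) (9 ^ n) O ∧
      ∃ k l : ℕ, 2 * k = 36 ^ (2 * n) + 36 ^ n ∧ 4 * l = 36 ^ (2 * n) + 2 * 36 ^ n ∧
        IsLSSD (arrayGraph O (kroneckerPow hadamard36 n)) Prod.fst (36 ^ (2 * n)) k l ∧
        IsOptimistic (arrayGraph O (kroneckerPow hadamard36 n)) Prod.fst (36 ^ (2 * n)) k := by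
  have hH := isRegularHadamard_hadamard36.kroneckerPow n
  refine ⟨isRegularHadamard_hadamard36, hH, ?_⟩
  have : Fact (Nat.Prime 3) := ⟨Nat.prime_three⟩
  have h4 : 4 ^ n = 2 ^ (2 * n) := by rw [pow_mul]; norm_num
  have h9 : 9 ^ n = 3 ^ (2 * n) := by rw [pow_mul]; norm_num
  have hm : 36 ^ (2 * n) = (36 ^ n) ^ 2 := by rw [← pow_mul, mul_comm]
  have h49 : 4 ^ n ≤ 9 ^ n := Nat.pow_le_pow_left (by norm_num) n
  obtain ⟨O, hO⟩ : ∃ O : Fin (36 ^ (2 * n)) → Fin (4 ^ n + 1) → Fin (36 ^ n),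
      IsMacNeishArray (4 ^ n) (9 ^ n) O := by
    rw [h9] at h49 ⊢
    rw [h4] at h49 ⊢
    -- All 4 ^ n + 1 columns over the smaller field are used, and equally many over the larger.
    refine exists_isMacNeishArray (by omega) (by omega) le_rfl (by omega) ?_ hm
    rw [← h4, ← h9, ← mul_pow]
    norm_num
  have hOA := hO.isOrthogonalArray hm
  have hN : 2 ≤ 4 ^ n + 1 := Nat.succ_le_succ (Nat.one_le_pow _ _ (by norm_num))
  have hs : 0 < 36 ^ n := by positivity
  -- With s = 4t the four parameters become visibly integral.
  obtain ⟨t, ht⟩ : 4 ∣ 36 ^ n := (by norm_num : 4 ∣ 36).trans (dvd_pow_self 36 (by omega))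
  have hsq : (36 ^ n) ^ 2 = 4 * (t * 36 ^ n) := by rw [sq, ← mul_assoc, ← ht]
  have hlink := hasLinkConstants_arrayGraph (μ := t * 36 ^ n + 3 * t) (ν := t * 36 ^ n + t)
    hOA hN hs hH (by omega) (by omega)
  refine ⟨O, hOA, hO, 2 * (t * 36 ^ n) + 2 * t, t * 36 ^ n + 2 * t, by omega, by omega, ?_, ?_⟩
  · refine ⟨hN, fun x y hxy h => h.1 hxy, fun i j hij => ?_, _, _, hlink⟩
    have := isSymmetricDesign_arrayGraph hOA hN hs hH (k := 2 * (t * 36 ^ n) + 2 * t)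
      (l := t * 36 ^ n + 2 * t) (by omega) (by omega) hij
    rwa [← hm] at this
  · refine ⟨_, _, hlink, ?_⟩
    have ht0 : 0 < t := by omega
    -- Here 2k - v = 4t and μ - ν = 2t.
    rw [hm, hsq]
    push_cast
    ring_nf
    positivity
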